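/- Let $K$ be a field. For a set $X$ let $\langle X\rangle$ be the free abelian monoid on $X$. A \emph{basic Bergman presentation} $(X,R)$ consists of a finite set $X$ of generators and a finite family $R=\{a_i=b_i\mid i\in I\}$ of relations with $a_i,b_i\in\langle X\rangle\setminus\{0\}$ (it is a Bergman presentation, i.e. a finite abelian monoid presentation with nonzero sides and relations coloured blue or red subject to certain conditions, in which there are no blue relations). Its \emph{Bergman algebra} $B(X,R)$ is the unital $K$-algebra obtained from $K^X$ by adjoining, for every $i\in I$, a universal isomorphism between the finitely generated projective modules $P_{a_i}$ and $P_{b_i}$; here, if $e_x\in K^X$ is the unit vector of $x\in X$ and $c=x_1+\dots+x_n\in\langle X\rangle$, then $P_c=\bigoplus_{k}K^Xe_{x_k}$ is represented by the idempotent matrix $\epsilon_c=\operatorname{diag}(e_{x_1},\dots,e_{x_n})$. Explicitly, one adjoins to $K^X$ the entries of matrices $\sigma_i,\sigma_i'$ subject to $\epsilon_{a_i}\sigma_i\epsilon_{b_i}=\sigma_i$, $\epsilon_{b_i}\sigma_i'\epsilon_{a_i}=\sigma_i'$, $\sigma_i\sigma_i'=\epsilon_{a_i}$ and $\sigma_i'\sigma_i=\epsilon_{b_i}$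 for all $i\in I$. \textbf{Theorem.} (1) Let $(X,R)$ be a basic Bergman presentation, and let $x\in X$ and $i\in I$ be such that $a_i=x$ and $x$ is not a summand of $b_i$. For $j\in I\setminus\{i\}$ let $a_j'$ and $b_j'$ be obtained from $a_j$ and $b_j$ by replacing each occurrence of $x$ by $b_i$. Then $(X\setminus\{x\},\{a'_j=b'_j\mid j\in I\setminus\{i\}\})$ is a basic Bergman presentation whose Bergman algebra is Morita equivalent to $B(X,R)$. (2) Let $H$ be a basic Bergman graph, i.e. a finite set $H^0$ of vertices and a finite set $H^1$ of hyperedges together with nonempty source and range multisets $s(g),r(g):H^0\to\mathbb N_0$ for every $g\in H^1$ (no hyperedge being blue). Its Bergman algebra $B(H)$ is the Bergman algebra of the presentation with generators $H^0$ and relations $\sum_{u}s(g)(u)u=\sum_{u}r(g)(u)u$ $(g\in H^1)$. Let $v\in H^0$ and $h\in H^1$ be such that $s(h)=\{v\}$ (with multiplicity one) and $r(h)(v)=0$. Let $H'$ have vertex set $H^0\setminus\{v\}$, hyperedge set $H^1\setminus\{h\}$, and \[s'(g)(u)=s(g)(u)+s(g)(v)\,r(h)(u),\qquad r'(g)(u)=r(g)(u)+r(g)(v)\,r(h)(u).\]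 Then $H'$ is a basic Bergman graph, and $B(H')$ is Morita equivalent to $B(H)$. Here two $K$-algebras are called Morita equivalent if their categories of left modules are $K$-linearly equivalent; in particular they are then Morita equivalent as rings. -/

import Mathlib

universe u v w w'

noncomputable section

namespace Bergman

/-! ### Adjoining generators and relations to a `K`-algebra -/

section Adjoining

variable (K : Type u) [Field K]

/-- The relations which make the map from `A` to the free algebra on `A ⊕ G` a `K`-algebra
homomorphism. -/
inductive FreeExtRel (A : Type v) [Ring A] [Algebra K A] (G : Type w) :
    FreeAlgebra K (A ⊕ G) → FreeAlgebra K (A ⊕ G) → Prop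
  | add (r s : A) : FreeExtRel A G (FreeAlgebra.ι K (Sum.inl (r + s)))
      (FreeAlgebra.ι K (Sum.inl r) + FreeAlgebra.ι K (Sum.inl s))
  | mul (r s : A) : FreeExtRel A G (FreeAlgebra.ι K (Sum.inl (r * s)))
      (FreeAlgebra.ι K (Sum.inl r) * FreeAlgebra.ι K (Sum.inl s))
  | scalar (k : K) : FreeExtRel A G (FreeAlgebra.ι K (Sum.inl (algebraMap K A k)))
      (algebraMap K (FreeAlgebra K (A ⊕ G)) k)

/-- The free product of the `K`-algebra `A` and the free unital `K`-algebra on the set `G`. -/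
abbrev FreeExt (A : Type v) [Ring A] [Algebra K A] (G : Type w) : Type (max u v w) :=
  RingQuot (FreeExtRel K A G)

/-- The canonical map from `A` to the free product. -/
def FreeExt.base {A : Type v} [Ring A] [Algebra K A] (G : Type w) (r : A) : FreeExt K A G :=
  RingQuot.mkAlgHom K (FreeExtRel K A G) (FreeAlgebra.ι K (Sum.inl r))

/-- The adjoined generator `g`. -/
def FreeExt.gen (A : Type v) [Ring A] [Algebra K A] {G : Type w} (g : G) : FreeExt K A G :=
  RingQuot.mkAlgHom K (FreeExtRel K A G) (FreeAlgebra.ι K (Sum.inr g))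

end Adjoining

/-- A square matrix over `A` together with its finite index set. -/
structure SqMatrix (A : Type u) : Type (max u (v + 1)) where
  ι : Type v
  [fin : Fintype ι]
  mat : Matrix ι ι A

attribute [instance] SqMatrix.fin

/-- Given square matrices `ε x` (`x ∈ X`) and an element `c` of the free abelian monoid on `X`,
the block diagonal matrix `ε_c` which has one block `ε x` for each summand `x` of `c`. The pairs
`(x, k)` with `k < c x` label the summands of `c`. -/
def SqMatrix.ofSum {X : Type v} [Fintype X] [DecidableEq X] {A : Type u} [Ring A]
    (ε : X → SqMatrix.{u, v} A) (c : X →₀ ℕ) : SqMatrix.{u, v} A where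
  ι := Σ p : (Σ x : X, Fin (c x)), (ε p.1).ι
  mat := Matrix.blockDiagonal' fun p : (Σ x : X, Fin (c x)) => (ε p.1).mat

/-! ### The universal isomorphisms `A⟨[P_j] = [Q_j] (j ∈ J)⟩` -/

section UniversalIso

variable (K : Type u) [Field K] {A : Type v} [Ring A] [Algebra K A] {J : Type w'}

/-- The entries of the adjoined matrices `σ_j` (left) and `σ'_j` (right). -/
abbrev IsoGen (ζ η : J → SqMatrix.{v, w} A) : Type (max w w') :=
  Σ j : J, ((ζ j).ι × (η j).ι) ⊕ ((η j).ι × (ζ j).ι)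

variable (ζ η : J → SqMatrix.{v, w} A)

/-- The adjoined matrix `σ_j`. -/
def isoMat (j : J) : Matrix (ζ j).ι (η j).ι (FreeExt K A (IsoGen ζ η)) :=
  Matrix.of fun p q => FreeExt.gen K A ⟨j, Sum.inl (p, q)⟩

/-- The adjoined matrix `σ'_j`. -/
def isoMatInv (j : J) : Matrix (η j).ι (ζ j).ι (FreeExt K A (IsoGen ζ η)) :=
  Matrix.of fun q p => FreeExt.gen K A ⟨j, Sum.inr (q, p)⟩

/-- The matrix `ζ_j` over the free product. -/
def isoSource (j : J) : Matrix (ζ j).ι (ζ j).ι (FreeExt K A (IsoGen ζ η)) :=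
  (ζ j).mat.map (FreeExt.base K (IsoGen ζ η))

/-- The matrix `η_j` over the free product. -/
def isoTarget (j : J) : Matrix (η j).ι (η j).ι (FreeExt K A (IsoGen ζ η)) :=
  (η j).mat.map (FreeExt.base K (IsoGen ζ η))

/-- The relations `ζση = σ`, `ησ'ζ = σ'`, `σσ' = ζ`, `σ'σ = η`, entry by entry. -/
inductive IsoRel : FreeExt K A (IsoGen ζ η) → FreeExt K A (IsoGen ζ η) → Prop
  | corner (j : J) (p : (ζ j).ι) (q : (η j).ι) :
      IsoRel ((isoSource K ζ η j * isoMat K ζ η j * isoTarget K ζ η j) p q)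
        (isoMat K ζ η j p q)
  | cornerInv (j : J) (q : (η j).ι) (p : (ζ j).ι) :
      IsoRel ((isoTarget K ζ η j * isoMatInv K ζ η j * isoSource K ζ η j) q p)
        (isoMatInv K ζ η j q p)
  | mulInv (j : J) (p p' : (ζ j).ι) :
      IsoRel ((isoMat K ζ η j * isoMatInv K ζ η j) p p') (isoSource K ζ η j p p')
  | invMul (j : J) (q q' : (η j).ι) :
      IsoRel ((isoMatInv K ζ η j * isoMat K ζ η j) q q') (isoTarget K ζ η j q q')

/-- If `ζ_j` and `η_j` are idempotent matrices representing the finitely generated projective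
`A`-modules `P_j` and `Q_j`, this is the `K`-algebra obtained from `A` by adjoining, for all `j`
at once, a universal isomorphism between the modules induced by `P_j` and `Q_j`. -/
abbrev IsoExt : Type (max u v w w') := RingQuot (IsoRel K ζ η)

end UniversalIso

/-! ### The universal decomposition `A⟨[P_x] (x ∈ S) | [P] = ∑ [P_x]⟩` -/

section UniversalSum

variable (K : Type u) [Field K] {A : Type v} [Ring A] [Algebra K A] {X : Type w}

/-- The entries of the adjoined matrices `ε_x` (`x ∈ S`). -/
abbrev SumGen (S : Finset X) (ζ : SqMatrix.{v, w} A) : Type w := S × ζ.ι × ζ.ι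

variable (S : Finset X) (ζ : SqMatrix.{v, w} A)

/-- The adjoined matrix `ε_x`. -/
def sumMat (x : S) : Matrix ζ.ι ζ.ι (FreeExt K A (SumGen S ζ)) :=
  Matrix.of fun p q => FreeExt.gen K A (x, p, q)

/-- The matrix `ζ` over the free product. -/
def sumSource : Matrix ζ.ι ζ.ι (FreeExt K A (SumGen S ζ)) :=
  ζ.mat.map (FreeExt.base K (SumGen S ζ))

/-- The relations `ζ ε_x ζ = ε_x`, `ε_x ε_x = ε_x`, `ε_x ε_y = 0` for `x ≠ y`, and `∑ ε_x = ζ`,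
entry by entry. (The last relation expresses one of the `ε_x` through the other ones; the relations
which involve this one follow from those between the others.) -/
inductive SumRel : FreeExt K A (SumGen S ζ) → FreeExt K A (SumGen S ζ) → Prop
  | corner (x : S) (p q : ζ.ι) :
      SumRel ((sumSource K S ζ * sumMat K S ζ x * sumSource K S ζ) p q) (sumMat K S ζ x p q)
  | idem (x : S) (p q : ζ.ι) :
      SumRel ((sumMat K S ζ x * sumMat K S ζ x) p q) (sumMat K S ζ x p q)
  | orth (x y : S) (hxy : x ≠ y) (p q : ζ.ι) :
      SumRel ((sumMat K S ζ x * sumMat K S ζ y) p q) 0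
  | total (p q : ζ.ι) : SumRel ((∑ x : S, sumMat K S ζ x) p q) (sumSource K S ζ p q)

/-- If `ζ` is an idempotent matrix representing the finitely generated projective `A`-module `P`,
this is the `K`-algebra obtained from `A` by adjoining a universal direct sum decomposition,
with summands indexed by `S`, of the module induced by `P`. -/
abbrev SumExt : Type (max u v w) := RingQuot (SumRel K S ζ)

end UniversalSum

/-! ### Bergman presentations -/

/-- `BaseGen b blue` is the set of elements that lie in no `supp (b i)` with `i` blue. -/
def BaseGen {X : Type v} {I : Type w} (b : I → X → ℕ) (blue : Set I) : Set X :=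
  {x | ∀ i ∈ blue, b i x = 0}

/-- The list `l` is an admissible ordering of the set `blue`, for relations `a i = b i`: each
summand of the left hand side of a blue relation is a base generator or a summand of the right hand
side of an earlier blue relation. -/
def IsAdmissible {X : Type v} {I : Type w} (a b : I → X → ℕ) (blue : Set I) (l : List I) : Prop :=
  l.Nodup ∧ (∀ i, i ∈ l ↔ i ∈ blue) ∧
    ∀ (k : ℕ) (hk : k < l.length) (x : X), a l[k] x ≠ 0 →
      x ∈ BaseGen b blue ∨ ∃ (p : ℕ) (hp : p < k), b (l[p]'(hp.trans hk)) x ≠ 0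

/-- A Bergman presentation with (finite) set of generators `X` and relations `a i = b i` indexed
by the (finite) set `I`. The relations which are not blue are red. -/
structure BergmanPresentation (X : Type v) (I : Type w) where
  a : I → X →₀ ℕ
  b : I → X →₀ ℕ
  blue : Set I
  a_ne_zero : ∀ i, a i ≠ 0
  b_ne_zero : ∀ i, b i ≠ 0
  /-- `b i` is the sum of the elements of a set `X_i`, -/
  blue_eq_sum : ∀ i ∈ blue, b i = ∑ x ∈ (b i).support, Finsupp.single x 1
  /-- where `X_i` has at least two elements, -/
  blue_two_le : ∀ i ∈ blue, 2 ≤ (b i).support.card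
  /-- and the sets `X_i` are pairwise disjoint. -/
  blue_disjoint : blue.Pairwise fun i j => Disjoint (b i).support (b j).support
  exists_admissible : ∃ l : List I, IsAdmissible (fun i => ⇑(a i)) (fun i => ⇑(b i)) blue l

namespace BergmanPresentation

variable {X : Type v} {I : Type w}

/-- The set of base generators. -/
def base (P : BergmanPresentation X I) : Set X := BaseGen (fun i => ⇑(P.b i)) P.blue

/-- All generators are base generators. -/
def IsBasic (P : BergmanPresentation X I) : Prop := P.base = Set.univ

/-- A chosen admissible ordering of the blue relations. -/
def ordering (P : BergmanPresentation X I) : List I := P.exists_admissible.choose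

end BergmanPresentation

/-! ### Bergman algebras -/

/-- A stage in the construction of a Bergman algebra: a `K`-algebra `A` and, for every generator
`x` that has already been adjoined, a matrix `ε x` over `A` representing the corresponding
projective module (for the other generators, a `0 × 0` matrix). -/
structure Stage (K : Type u) [Field K] (X : Type v) : Type (max u v + 1) where
  A : Type (max u v)
  [ring : Ring A]
  [algebra : Algebra K A]
  ε : X → SqMatrix.{max u v, v} A

attribute [instance] Stage.ring Stage.algebra

namespace BergmanPresentation

variable (K : Type u) [Field K] {X : Type v} [Fintype X] [DecidableEq X] {I : Type w}

open Classical in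
/-- The algebra `K^{X_base}`, where the base generator `x` is represented by the `1 × 1` matrix
whose entry is the corresponding unit vector. -/
def initialStage (P : BergmanPresentation X I) : Stage K X where
  A := P.base → K
  ε x := if h : x ∈ P.base then ⟨PUnit, fun _ _ => Pi.single ⟨x, h⟩ 1⟩ else ⟨PEmpty, 0⟩

open Classical in
/-- Adjoining the generators `x ∈ X_i` and the blue relation `a i = ∑_{x ∈ X_i} x`. -/
def blueStep (P : BergmanPresentation X I) (T : Stage K X) (i : I) : Stage K X where
  A := SumExt K (P.b i).support (SqMatrix.ofSum T.ε (P.a i))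
  ε x :=
    if h : x ∈ (P.b i).support then
      ⟨(SqMatrix.ofSum T.ε (P.a i)).ι,
        (sumMat K (P.b i).support (SqMatrix.ofSum T.ε (P.a i)) ⟨x, h⟩).map
          (RingQuot.mkAlgHom K (SumRel K (P.b i).support (SqMatrix.ofSum T.ε (P.a i))))⟩
    else
      ⟨(T.ε x).ι, (T.ε x).mat.map fun r =>
        RingQuot.mkAlgHom K (SumRel K (P.b i).support (SqMatrix.ofSum T.ε (P.a i)))
          (FreeExt.base K _ r)⟩

/-- The stage reached when the blue relations in the list `l` have been adjoined in this order. -/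
def blueStage (P : BergmanPresentation X I) (l : List I) : Stage K X :=
  l.foldl (P.blueStep K) (P.initialStage K)

/-- Adjoining all red relations to the stage `T`. -/
abbrev redAlgebra (P : BergmanPresentation X I) (T : Stage K X) : Type (max u v w) :=
  IsoExt K (fun j : {i : I // i ∉ P.blue} => SqMatrix.ofSum T.ε (P.a j))
    (fun j : {i : I // i ∉ P.blue} => SqMatrix.ofSum T.ε (P.b j))

/-- The Bergman algebra `B(X, R)`. -/
abbrev algebra (P : BergmanPresentation X I) : Type (max u v w) :=
  P.redAlgebra K (P.blueStage K P.ordering)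

end BergmanPresentation

/-! ### Collapsing a Bergman presentation -/

section Substitution

variable {X : Type v} [DecidableEq X]

/-- The element obtained from `c` by replacing any occurrence of the generator `x` by `b`. -/
def substitute (x : X) (b c : X →₀ ℕ) : X →₀ ℕ :=
  c.sum fun y n => n • if y = x then b else Finsupp.single y 1

theorem substitute_apply_of_ne (x : X) (b c : X →₀ ℕ) {u : X} (hu : u ≠ x) :
    substitute x b c u = c u + c x * b u := by
  have key : ∀ y ∈ c.support, (c y • if y = x then b else Finsupp.single y 1) u =
      (if y = u then c y else 0) + (if y = x then c y * b u else 0) := by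
    intro y _
    by_cases hyx : y = x
    · subst hyx
      simp [Ne.symm hu]
    · simp [hyx, Finsupp.single_apply]
  rw [substitute, Finsupp.sum, Finsupp.finsetSum_apply, Finset.sum_congr rfl key,
    Finset.sum_add_distrib, Finset.sum_ite_eq', Finset.sum_ite_eq']
  by_cases h1 : c u = 0 <;> by_cases h2 : c x = 0 <;> simp [h1, h2]

/-- If `x` is not a summand of `b`, it is not a summand of the result of the replacement. -/
theorem substitute_apply_self (x : X) (b c : X →₀ ℕ) (hb : b x = 0) :
    substitute x b c x = 0 := by
  rw [substitute, Finsupp.sum, Finsupp.finsetSum_apply]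
  refine Finset.sum_eq_zero fun y _ => ?_
  by_cases hyx : y = x
  · simp [hyx, hb]
  · simp [hyx]

/-- The replacement as an element of the free abelian monoid on `X \ {x}`. -/
def collapseSum (x : X) (b c : X →₀ ℕ) : {y : X // y ≠ x} →₀ ℕ :=
  (substitute x b c).subtypeDomain fun y => y ≠ x

theorem collapseSum_ne_zero (x : X) {b c : X →₀ ℕ} (hb : b ≠ 0) (hbx : b x = 0) (hc : c ≠ 0) :
    collapseSum x b c ≠ 0 := by
  intro h
  have key : ∀ u, u ≠ x → c u + c x * b u = 0 := fun u hu =>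
    (substitute_apply_of_ne x b c hu).symm.trans (DFunLike.congr_fun h ⟨u, hu⟩)
  obtain ⟨z, hz⟩ := Finsupp.ne_iff.1 hb
  have hzx : z ≠ x := fun e => hz (by simp [e, hbx])
  have hcx : c x = 0 := by
    have := key z hzx
    simp only [Nat.add_eq_zero_iff, mul_eq_zero] at this
    exact this.2.resolve_right hz
  refine hc (Finsupp.ext fun u => ?_)
  by_cases hu : u = x
  · simpa [hu] using hcx
  · have := key u hu
    simp only [Finsupp.coe_zero, Pi.zero_apply]
    omega

end Substitution

namespace BergmanPresentation

variable {X : Type v} {I : Type w}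

theorem IsBasic.blue_eq_empty {P : BergmanPresentation X I} (hP : P.IsBasic) : P.blue = ∅ := by
  refine Set.eq_empty_iff_forall_notMem.2 fun i hi => P.b_ne_zero i (Finsupp.ext fun x => ?_)
  have hx : x ∈ P.base := hP ▸ Set.mem_univ x
  exact hx i hi

/-- Collapsing a basic presentation with `i`-th relation `x = b i`, where `x` is not a summand of
`b i`: the generator `x` and the `i`-th relation are removed, and in all other relations any
occurrence of `x` is replaced by `b i`. (The hypothesis `P.a i = x` is not needed for the
construction to make sense.) -/
def collapse [DecidableEq X] (P : BergmanPresentation X I) (hP : P.IsBasic) (x : X) (i : I)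
    (hx : P.b i x = 0) : BergmanPresentation {y : X // y ≠ x} {j : I // j ≠ i} where
  a j := collapseSum x (P.b i) (P.a j)
  b j := collapseSum x (P.b i) (P.b j)
  blue := {j | j.1 ∈ P.blue}
  a_ne_zero j := collapseSum_ne_zero x (P.b_ne_zero i) hx (P.a_ne_zero j)
  b_ne_zero j := collapseSum_ne_zero x (P.b_ne_zero i) hx (P.b_ne_zero j)
  blue_eq_sum j hj := by simp [hP.blue_eq_empty] at hj
  blue_two_le j hj := by simp [hP.blue_eq_empty] at hj
  blue_disjoint j hj := by simp [hP.blue_eq_empty] at hj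
  exists_admissible := ⟨[], by simp [IsAdmissible, hP.blue_eq_empty]⟩

end BergmanPresentation

/-! ### Bergman graphs -/

/-- A Bergman graph with (finite) vertex set `V` and (finite) set of hyperedges `E`. Multisets over
`V` are maps `V → ℕ`. The hyperedges which are not blue are red. -/
structure BergmanGraph (V : Type v) (E : Type w) where
  s : E → V → ℕ
  r : E → V → ℕ
  blue : Set E
  s_ne_zero : ∀ h, s h ≠ 0
  r_ne_zero : ∀ h, r h ≠ 0
  /-- The range multiset of a blue hyperedge is a set -/
  blue_le_one : ∀ h ∈ blue, ∀ v, r h v ≤ 1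
  /-- with at least two elements, -/
  blue_two_le : ∀ h ∈ blue, ∃ v v', v ≠ v' ∧ r h v ≠ 0 ∧ r h v' ≠ 0
  /-- and these sets are pairwise disjoint. -/
  blue_disjoint : blue.Pairwise fun h g => ∀ v, r h v = 0 ∨ r g v = 0
  exists_admissible : ∃ l : List E, IsAdmissible s r blue l

namespace BergmanGraph

variable {V : Type v} {E : Type w}

/-- All vertices are base vertices, i.e. no vertex is a range of a blue hyperedge. -/
def IsBasic (H : BergmanGraph V E) : Prop := BaseGen H.r H.blue = Set.univ

/-- The Bergman presentation that corresponds to a Bergman graph: its generators are the vertices,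
and each hyperedge `h` gives the relation `∑ s(h) = ∑ r(h)` of the same colour. -/
def toPresentation [Fintype V] (H : BergmanGraph V E) : BergmanPresentation V E where
  a h := Finsupp.equivFunOnFinite.symm (H.s h)
  b h := Finsupp.equivFunOnFinite.symm (H.r h)
  blue := H.blue
  a_ne_zero h h0 := H.s_ne_zero h (funext fun v => DFunLike.congr_fun h0 v)
  b_ne_zero h h0 := H.r_ne_zero h (funext fun v => DFunLike.congr_fun h0 v)
  blue_eq_sum h hh := by
    classical
    ext v
    have h1 := H.blue_le_one h hh v
    by_cases h0 : H.r h v = 0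
    · simp [Finsupp.finsetSum_apply, Finsupp.single_apply, h0]
    · have h2 : H.r h v = 1 := by omega
      simp [Finsupp.finsetSum_apply, Finsupp.single_apply, h2]
  blue_two_le h hh := by
    obtain ⟨v, v', hne, hv, hv'⟩ := H.blue_two_le h hh
    exact Finset.one_lt_card.2 ⟨v, by simpa using hv, v', by simpa using hv', hne⟩
  blue_disjoint h hh g hg hne := by
    refine Finset.disjoint_left.2 fun v hv hv' => ?_
    have h1 := H.blue_disjoint hh hg hne v
    simp only [Finsupp.mem_support_iff, Finsupp.equivFunOnFinite_symm_apply_apply] at hv hv'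
    exact h1.elim hv hv'
  exists_admissible := H.exists_admissible

/-- The Bergman algebra `B(H)`. -/
abbrev algebra (K : Type u) [Field K] [Fintype V] [DecidableEq V] (H : BergmanGraph V E) :
    Type (max u v w) :=
  H.toPresentation.algebra K

theorem IsBasic.blue_eq_empty {H : BergmanGraph V E} (hH : H.IsBasic) : H.blue = ∅ := by
  refine Set.eq_empty_iff_forall_notMem.2 fun h hh => H.r_ne_zero h (funext fun v => ?_)
  have hv : v ∈ BaseGen H.r H.blue := hH ▸ Set.mem_univ v
  exact hv h hh

theorem collapse_ne_zero {v : V} {m n : V → ℕ} (hm : m ≠ 0) (hmv : m v = 0) (hn : n ≠ 0) :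
    (fun u : {u : V // u ≠ v} => n u + n v * m u) ≠ 0 := by
  intro h
  obtain ⟨z, hz⟩ := Function.ne_iff.1 hm
  have hzv : z ≠ v := fun e => hz (by simp [e, hmv])
  have hnv : n v = 0 := by
    have := congr_fun h ⟨z, hzv⟩
    simp only [Pi.zero_apply, Nat.add_eq_zero_iff, mul_eq_zero] at this
    exact this.2.resolve_right hz
  refine hn (funext fun u => ?_)
  by_cases hu : u = v
  · simpa [hu] using hnv
  · have := congr_fun h ⟨u, hu⟩
    simp only [Pi.zero_apply] at this ⊢
    omega

/-- Collapsing a basic Bergman graph with hyperedge `h` such that `s h = {v}` and `v` is not a range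
of `h`: the vertex `v` and the hyperedge `h` are removed, and in the sources and ranges of the
other hyperedges each occurrence of `v` is replaced by the multiset `r h`. (The hypothesis
`s h = {v}` is not needed for the construction to make sense.) -/
def collapse (H : BergmanGraph V E) (hH : H.IsBasic) (v : V) (h : E) (hv : H.r h v = 0) :
    BergmanGraph {u : V // u ≠ v} {g : E // g ≠ h} where
  s g u := H.s g u + H.s g v * H.r h u
  r g u := H.r g u + H.r g v * H.r h u
  blue := {g | g.1 ∈ H.blue}
  s_ne_zero g := collapse_ne_zero (H.r_ne_zero h) hv (H.s_ne_zero g)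
  r_ne_zero g := collapse_ne_zero (H.r_ne_zero h) hv (H.r_ne_zero g)
  blue_le_one g hg := by simp [hH.blue_eq_empty] at hg
  blue_two_le g hg := by simp [hH.blue_eq_empty] at hg
  blue_disjoint g hg := by simp [hH.blue_eq_empty] at hg
  exists_admissible := ⟨[], by simp [IsAdmissible, hH.blue_eq_empty]⟩

end BergmanGraph

end Bergman

end

/-!
Modules over a basic Bergman algebra are representations of the presentation: `K`-modules `V x` for
the generators `x`, together with isomorphisms `⨁ V (gen k) ≃ ⨁ V (gen l)` for the relations.
Indeed, the idempotents cut a module `M` into its summands `e x • M`, between which the adjoined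
matrices act; conversely, the universal property of the Bergman algebra makes it act on the product
of all `V x`. If one of the relations is `x = b`, where `x` is not a summand of `b`, then the
isomorphism of this relation identifies `V x` with the direct sum that corresponds to `b`. Hence a
representation amounts to one of the remaining generators that satisfies the other relations after
substituting `b` for `x`.
-/

noncomputable section

namespace Bergman

open CategoryTheory

universe t

/-! ### Labelled sums of generators -/

/-- An element `∑ k, gen k` of the free abelian monoid on `X` whose summands are labelled by a
finite type `ι`. Direct sums and block matrices are indexed by `ι`, so that substituting sums for
generators does not require choosing an order of the summands. -/
structure LabeledSum (X : Type v) where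
  ι : Type v
  [fintype : Fintype ι]
  [decEq : DecidableEq ι]
  gen : ι → X

namespace LabeledSum

attribute [instance] fintype decEq

variable {X Y : Type v}

/-- The underlying element of the free abelian monoid on `X`. -/
def toFinsupp (w : LabeledSum X) : X →₀ ℕ := ∑ k, Finsupp.single (w.gen k) 1

/-- The sum with the single summand `x`. -/
def pure (x : X) : LabeledSum X := ⟨PUnit, fun _ => x⟩

/-- The image of a sum under a map of generators. -/
def map (f : X → Y) (w : LabeledSum X) : LabeledSum Y := ⟨w.ι, f ∘ w.gen⟩

/-- The sum obtained by substituting `s x` for each generator `x`. -/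
def bind (w : LabeledSum X) (s : X → LabeledSum Y) : LabeledSum Y :=
  ⟨Σ k, (s (w.gen k)).ι, fun p => (s (w.gen p.1)).gen p.2⟩

/-- A labelling of the summands of an element of the free abelian monoid. -/
def ofFinsupp [Fintype X] [DecidableEq X] (c : X →₀ ℕ) : LabeledSum X :=
  ⟨Σ x, Fin (c x), Sigma.fst⟩

/-- The diagonal matrix with entries `e (gen k)`, which represents the direct sum of the projective
modules given by the idempotents `e (gen k)`. -/
def diag {C : Type*} [Zero C] (w : LabeledSum X) (e : X → C) : Matrix w.ι w.ι C :=
  Matrix.diagonal (e ∘ w.gen)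

theorem toFinsupp_apply [DecidableEq X] (w : LabeledSum X) (x : X) :
    w.toFinsupp x = Fintype.card {k // w.gen k = x} := by
  simp [toFinsupp, Finsupp.finsetSum_apply, Finsupp.single_apply, Fintype.card_subtype]

@[simp] theorem toFinsupp_pure (x : X) : (pure x).toFinsupp = Finsupp.single x 1 :=
  Fintype.sum_unique fun _ : PUnit => Finsupp.single x 1

@[simp] theorem toFinsupp_map (f : X → Y) (w : LabeledSum X) :
    (w.map f).toFinsupp = w.toFinsupp.mapDomain f := by
  rw [toFinsupp, toFinsupp, Finsupp.mapDomain_finsetSum]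
  exact Finset.sum_congr rfl fun k _ => (Finsupp.mapDomain_single (f := f)).symm

@[simp] theorem toFinsupp_bind (w : LabeledSum X) (s : X → LabeledSum Y) :
    (w.bind s).toFinsupp = w.toFinsupp.sum fun x n => n • (s x).toFinsupp := by
  have h : (w.bind s).toFinsupp = ∑ k, (s (w.gen k)).toFinsupp := Fintype.sum_sigma _
  rw [h, toFinsupp, ← Finsupp.sum_finsetSum_index (by simp) fun _ _ _ => add_smul ..]
  simp

@[simp] theorem toFinsupp_ofFinsupp [Fintype X] [DecidableEq X] (c : X →₀ ℕ) :
    (ofFinsupp c).toFinsupp = c := by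
  have h : (ofFinsupp c).toFinsupp = ∑ x, ∑ _ : Fin (c x), Finsupp.single x 1 :=
    Fintype.sum_sigma _
  ext x
  simp [h]

theorem map_diag {C D : Type*} [Zero C] [Zero D] (w : LabeledSum X) (e : X → C) (f : C → D)
    (hf : f 0 = 0) : (w.diag e).map f = w.diag (f ∘ e) :=
  Matrix.diagonal_map hf

end LabeledSum

theorem exists_equiv_comp_eq {ι κ X : Type*} [Fintype ι] [Fintype κ] [DecidableEq X] (p : ι → X)
    (q : κ → X) (h : ∀ x, Fintype.card {k // p k = x} = Fintype.card {l // q l = x}) :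
    ∃ e : ι ≃ κ, ∀ k, q (e k) = p k :=
  ⟨Equiv.ofFiberEquiv fun x => Fintype.equivOfCardEq (h x), Equiv.ofFiberEquiv_map _⟩

/-! ### Isomorphisms between idempotent matrices -/

/-- Mutually inverse isomorphisms `σ`, `τ` between the projective modules represented by the
idempotent matrices `Z` and `H`. -/
structure MatrixIso {C : Type*} [Ring C] {ι κ : Type*} [Fintype ι] [Fintype κ] (Z : Matrix ι ι C)
    (H : Matrix κ κ C) where
  σ : Matrix ι κ C
  τ : Matrix κ ι C
  corner : Z * σ * H = σ
  corner_symm : H * τ * Z = τ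
  mul_symm : σ * τ = Z
  symm_mul : τ * σ = H

namespace MatrixIso

variable {C : Type*} [Ring C] {ι κ ι' κ' : Type*} [Fintype ι] [Fintype κ] [Fintype ι']
  [Fintype κ'] {Z : Matrix ι ι C} {H : Matrix κ κ C}

/-- The same isomorphisms in the opposite direction. -/
@[simps] def symm (F : MatrixIso Z H) : MatrixIso H Z :=
  ⟨F.τ, F.σ, F.corner_symm, F.corner, F.symm_mul, F.mul_symm⟩

/-- The same isomorphisms after renaming the rows and columns of the idempotents. -/
@[simps] def reindex (F : MatrixIso Z H) (α : ι' ≃ ι) (β : κ' ≃ κ) {Z' : Matrix ι' ι' C}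
    {H' : Matrix κ' κ' C} (hZ : Z.submatrix α α = Z') (hH : H.submatrix β β = H') :
    MatrixIso Z' H' where
  σ := F.σ.submatrix α β
  τ := F.τ.submatrix β α
  corner := by simp only [← hZ, ← hH, Matrix.submatrix_mul_equiv, F.corner]
  corner_symm := by simp only [← hZ, ← hH, Matrix.submatrix_mul_equiv, F.corner_symm]
  mul_symm := by simp only [← hZ, Matrix.submatrix_mul_equiv, F.mul_symm]
  symm_mul := by simp only [← hH, Matrix.submatrix_mul_equiv, F.symm_mul]

end MatrixIso

/-! ### The universal property of the adjunction of isomorphisms -/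

section FreeExtLift

variable (K : Type u) [Field K] {A : Type v} [Ring A] [Algebra K A] (G : Type w)

/-- The canonical map from `A` to the free product as a homomorphism of algebras. -/
def FreeExt.baseHom : A →ₐ[K] FreeExt K A G :=
  have scalar (k : K) : FreeExt.base K G (algebraMap K A k) = algebraMap K _ k :=
    (RingQuot.mkAlgHom_rel K (FreeExtRel.scalar k)).trans (AlgHom.commutes _ k)
  { toFun := FreeExt.base K G
    map_one' := by simpa only [map_one] using scalar 1
    map_mul' := fun r s => (RingQuot.mkAlgHom_rel K (FreeExtRel.mul r s)).trans (map_mul ..)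
    map_zero' := by simpa only [map_zero] using scalar 0
    map_add' := fun r s => (RingQuot.mkAlgHom_rel K (FreeExtRel.add r s)).trans (map_add ..)
    commutes' := scalar }

variable {G} {C : Type w'} [Ring C] [Algebra K C]

/-- The universal property of the free product. -/
def FreeExt.lift (f : A →ₐ[K] C) (t : G → C) : FreeExt K A G →ₐ[K] C :=
  RingQuot.liftAlgHom K ⟨FreeAlgebra.lift K (Sum.elim f t), by rintro _ _ (_ | _ | _) <;> simp⟩

@[simp]
theorem FreeExt.lift_base (f : A →ₐ[K] C) (t : G → C) (a : A) :
    FreeExt.lift K f t (FreeExt.base K G a) = f a := by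
  simp [FreeExt.lift, FreeExt.base]

@[simp]
theorem FreeExt.lift_gen (f : A →ₐ[K] C) (t : G → C) (g : G) :
    FreeExt.lift K f t (FreeExt.gen K A g) = t g := by
  simp [FreeExt.lift, FreeExt.gen]

theorem eq_top_of_comap_mkAlgHom {B : Type*} [Semiring B] [Algebra K B] (r : B → B → Prop)
    (S : Subalgebra K (RingQuot r)) (h : S.comap (RingQuot.mkAlgHom K r) = ⊤) : S = ⊤ := by
  refine Algebra.eq_top_iff.2 fun z => ?_
  obtain ⟨y, rfl⟩ := RingQuot.mkAlgHom_surjective K r z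
  exact Algebra.eq_top_iff.1 h y

theorem FreeExt.eq_top (S : Subalgebra K (FreeExt K A G)) (hb : ∀ a, FreeExt.base K G a ∈ S)
    (hg : ∀ g, FreeExt.gen K A g ∈ S) : S = ⊤ := by
  refine eq_top_of_comap_mkAlgHom K _ S ?_
  rw [← top_le_iff, ← FreeAlgebra.adjoin_range_ι, Algebra.adjoin_le_iff]
  rintro _ ⟨a | g, rfl⟩
  exacts [hb a, hg g]

end FreeExtLift

namespace IsoExt

variable (K : Type u) [Field K] {A : Type v} [Ring A] [Algebra K A] {J : Type w'}
  (ζ η : J → SqMatrix.{v, w} A)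

/-- The canonical map from `A` to the algebra with universal isomorphisms adjoined. -/
def base : A →ₐ[K] IsoExt K ζ η :=
  (RingQuot.mkAlgHom K (IsoRel K ζ η)).comp (FreeExt.baseHom K (IsoGen ζ η))

/-- The adjoined isomorphisms. -/
@[simps] def iso (j : J) : MatrixIso ((ζ j).mat.map (base K ζ η)) ((η j).mat.map (base K ζ η)) where
  σ := (isoMat K ζ η j).map (RingQuot.mkAlgHom K (IsoRel K ζ η))
  τ := (isoMatInv K ζ η j).map (RingQuot.mkAlgHom K (IsoRel K ζ η))
  corner := Matrix.ext fun k l => by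
    have h := RingQuot.mkAlgHom_rel K (IsoRel.corner (K := K) (ζ := ζ) (η := η) j k l)
    simp only [Matrix.mul_apply, map_sum, map_mul] at h
    exact h
  corner_symm := Matrix.ext fun l k => by
    have h := RingQuot.mkAlgHom_rel K (IsoRel.cornerInv (K := K) (ζ := ζ) (η := η) j l k)
    simp only [Matrix.mul_apply, map_sum, map_mul] at h
    exact h
  mul_symm := Matrix.ext fun k k' => by
    have h := RingQuot.mkAlgHom_rel K (IsoRel.mulInv (K := K) (ζ := ζ) (η := η) j k k')
    simp only [Matrix.mul_apply, map_sum, map_mul] at h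
    exact h
  symm_mul := Matrix.ext fun l l' => by
    have h := RingQuot.mkAlgHom_rel K (IsoRel.invMul (K := K) (ζ := ζ) (η := η) j l l')
    simp only [Matrix.mul_apply, map_sum, map_mul] at h
    exact h

variable {ζ η}

theorem eq_top (S : Subalgebra K (IsoExt K ζ η)) (hb : ∀ a, base K ζ η a ∈ S)
    (hσ : ∀ j k l, (iso K ζ η j).σ k l ∈ S) (hτ : ∀ j l k, (iso K ζ η j).τ l k ∈ S) : S = ⊤ := by
  refine eq_top_of_comap_mkAlgHom K _ S (FreeExt.eq_top K _ hb ?_)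
  rintro ⟨j, ⟨k, l⟩ | ⟨l, k⟩⟩
  exacts [hσ j k l, hτ j l k]

theorem exists_lift {C : Type*} [Ring C] [Algebra K C] (f : A →ₐ[K] C)
    (F : ∀ j, MatrixIso ((ζ j).mat.map f) ((η j).mat.map f)) :
    ∃ g : IsoExt K ζ η →ₐ[K] C, (∀ a, g (base K ζ η a) = f a) ∧
      (∀ j k l, g ((iso K ζ η j).σ k l) = (F j).σ k l) ∧
      ∀ j l k, g ((iso K ζ η j).τ l k) = (F j).τ l k := by
  let φ : FreeExt K A (IsoGen ζ η) →ₐ[K] C := FreeExt.lift K f fun g =>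
    g.2.elim (fun p => (F g.1).σ p.1 p.2) fun p => (F g.1).τ p.1 p.2
  have hφ : ∀ ⦃a b⦄, IsoRel K ζ η a b → φ a = φ b := by
    rintro _ _ (⟨j, k, l⟩ | ⟨j, l, k⟩ | ⟨j, k, k'⟩ | ⟨j, l, l'⟩)
    · simpa [φ, Matrix.mul_apply, isoSource, isoTarget, isoMat] using congrFun₂ (F j).corner k l
    · simpa [φ, Matrix.mul_apply, isoSource, isoTarget, isoMatInv] using
        congrFun₂ (F j).corner_symm l k
    · simpa [φ, Matrix.mul_apply, isoSource, isoMat, isoMatInv] using congrFun₂ (F j).mul_symm k k'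
    · simpa [φ, Matrix.mul_apply, isoTarget, isoMat, isoMatInv] using congrFun₂ (F j).symm_mul l l'
  refine ⟨RingQuot.liftAlgHom K ⟨φ, hφ⟩, fun a => ?_, fun j k l => ?_, fun j l k => ?_⟩
  · exact (RingQuot.liftAlgHom_mkAlgHom_apply K φ hφ _).trans (FreeExt.lift_base K f _ a)
  · simp [φ, isoMat]
  · simp [φ, isoMatInv]

end IsoExt

/-! ### Bergman algebras as universal systems of isomorphisms -/

section System

variable {X : Type v} [Fintype X] {J : Type w}

/-- Orthogonal idempotents `e x` with sum `1` in `C`, and for every relation `a j = b j` an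
isomorphism between the sums of the corresponding projective `C`-modules. -/
structure IsoSystem (a b : J → LabeledSum X) (C : Type*) [Ring C] where
  e : X → C
  complete : CompleteOrthogonalIdempotents e
  iso : ∀ j, MatrixIso ((a j).diag e) ((b j).diag e)

variable {a b : J → LabeledSum X}

/-- The system with the two sides of all relations interchanged. -/
def IsoSystem.symm {C : Type*} [Ring C] (D : IsoSystem a b C) : IsoSystem b a C :=
  ⟨D.e, D.complete, fun j => (D.iso j).symm⟩

/-- The system `D` generates the `K`-algebra `B`, and every other system in a `K`-algebra (of the
same universe as a Bergman algebra) is an image of `D`. -/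
structure IsoSystem.IsUniversal (K : Type u) [CommRing K] {B : Type*} [Ring B] [Algebra K B]
    (D : IsoSystem a b B) : Prop where
  eq_top (S : Subalgebra K B) : (∀ x, D.e x ∈ S) → (∀ j k l, (D.iso j).σ k l ∈ S) →
    (∀ j l k, (D.iso j).τ l k ∈ S) → S = ⊤
  exists_lift {C : Type max u v w} [Ring C] [Algebra K C] (E : IsoSystem a b C) :
    ∃ f : B →ₐ[K] C, (∀ x, f (D.e x) = E.e x) ∧
      (∀ j k l, f ((D.iso j).σ k l) = (E.iso j).σ k l) ∧
      ∀ j l k, f ((D.iso j).τ l k) = (E.iso j).τ l k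

end System

section FunctionAlgebra

variable (K : Type u) [CommRing K] {X : Type v} [DecidableEq X]

theorem subalgebra_pi_eq_top [Finite X] (S : Subalgebra K (X → K)) (hS : ∀ x, Pi.single x 1 ∈ S) :
    S = ⊤ := by
  cases nonempty_fintype X
  refine Algebra.eq_top_iff.2 fun f => ?_
  rw [pi_eq_sum_univ' f]
  exact S.sum_mem fun x _ => S.smul_mem (by simpa [Pi.single_apply, eq_comm] using hS x) _

theorem exists_pi_algHom [Fintype X] {C : Type*} [Ring C] [Algebra K C] {e : X → C}
    (he : CompleteOrthogonalIdempotents e) :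
    ∃ f : (X → K) →ₐ[K] C, ∀ x, f (Pi.single x 1) = e x := by
  refine ⟨AlgHom.ofLinearMap (Fintype.linearCombination K e) ?_ fun f g => ?_, fun x => ?_⟩
  · simpa [Fintype.linearCombination_apply] using he.complete
  · simp [Fintype.linearCombination_apply, Finset.sum_mul_sum, he.mul_eq, smul_smul, mul_comm]
  · simp [Fintype.linearCombination_apply_single]

end FunctionAlgebra

theorem LabeledSum.map_submatrix_eq_diag {X : Type v} {w : LabeledSum X} {A C : Type*} [Zero A]
    [Zero C] {u : X → A} {ι : Type*} {M : Matrix ι ι A} {α : w.ι ≃ ι}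
    (h : M.submatrix α α = w.diag u) (f : A → C) (hf : f 0 = 0) :
    (M.map f).submatrix α α = w.diag (f ∘ u) :=
  (congrArg (Matrix.map · f) h).trans (w.map_diag u f hf)

namespace IsoExt

variable (K : Type u) [Field K] {X X' : Type v} [Fintype X] [Fintype X'] [DecidableEq X']
  {J : Type w} {I : Type*} (γ : X ≃ X') (δ : J ≃ I) {ζ η : I → SqMatrix.{max u v, v} (X' → K)}
  {a b : J → LabeledSum X} (α : ∀ j, (a j).ι ≃ (ζ (δ j)).ι) (β : ∀ j, (b j).ι ≃ (η (δ j)).ι)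
  (hα : ∀ j, (ζ (δ j)).mat.submatrix (α j) (α j) = (a j).diag fun x => Pi.single (γ x) 1)
  (hβ : ∀ j, (η (δ j)).mat.submatrix (β j) (β j) = (b j).diag fun x => Pi.single (γ x) 1)

/-- The system obtained by adjoining isomorphisms to the algebra of functions on the generators;
`γ` and `δ` allow the generators and the relations to be renamed. -/
def isoSystem : IsoSystem a b (IsoExt K ζ η) where
  e x := base K ζ η (Pi.single (γ x) 1)
  complete := (CompleteOrthogonalIdempotents.equiv γ).2 <|
    (CompleteOrthogonalIdempotents.single fun _ : X' => K).map (base K ζ η).toRingHom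
  iso j := (iso K ζ η (δ j)).reindex (α j) (β j)
    (LabeledSum.map_submatrix_eq_diag (hα j) (base K ζ η) (map_zero _))
    (LabeledSum.map_submatrix_eq_diag (hβ j) (base K ζ η) (map_zero _))

theorem isUniversal_isoSystem : (isoSystem K γ δ α β hα hβ).IsUniversal K where
  eq_top S he hσ hτ := by
    refine eq_top K S (fun f => ?_) (δ.surjective.forall.2 fun j => ?_)
      (δ.surjective.forall.2 fun j => ?_)
    · have := subalgebra_pi_eq_top K (S.comap (base K ζ η)) (γ.surjective.forall.2 he)
      exact this.ge (Algebra.mem_top (x := f))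
    · exact (α j).surjective.forall.2 fun k => (β j).surjective.forall.2 fun l => hσ j k l
    · exact (β j).surjective.forall.2 fun l => (α j).surjective.forall.2 fun k => hτ j l k
  exists_lift {C} _ _ E := by
    obtain ⟨f, hf⟩ := exists_pi_algHom K ((CompleteOrthogonalIdempotents.equiv γ.symm).2 E.complete)
    have hfE : (f ∘ fun x => Pi.single (γ x) 1) = E.e := funext fun x => by simp [hf]
    have hζ j : ((a j).diag E.e).submatrix (α j).symm (α j).symm = (ζ (δ j)).mat.map f := by
      rw [← hfE, ← LabeledSum.map_submatrix_eq_diag (hα j) f (map_zero f)]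
      simp
    have hη j : ((b j).diag E.e).submatrix (β j).symm (β j).symm = (η (δ j)).mat.map f := by
      rw [← hfE, ← LabeledSum.map_submatrix_eq_diag (hβ j) f (map_zero f)]
      simp
    let F := Equiv.piCongrLeft (fun i => MatrixIso ((ζ i).mat.map f) ((η i).mat.map f)) δ fun j =>
      (E.iso j).reindex (α j).symm (β j).symm (hζ j) (hη j)
    have hF j : F (δ j) = _ := Equiv.piCongrLeft_apply_apply _ _ _ _
    obtain ⟨g, hg, hgσ, hgτ⟩ := exists_lift K f F
    exact ⟨g, fun x => (hg _).trans (congrFun hfE x),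
      fun j k l => (hgσ _ _ _).trans (by simp [hF]), fun j l k => (hgτ _ _ _).trans (by simp [hF])⟩

end IsoExt

theorem SqMatrix.exists_submatrix_ofSum_eq_diag {X : Type v} [Fintype X] [DecidableEq X]
    {A : Type u} [Ring A] (u : X → A) {ε : X → SqMatrix.{u, v} A}
    (hε : ∀ x, ε x = ⟨PUnit, fun _ _ => u x⟩) {w : LabeledSum X}
    {c : X →₀ ℕ} (hw : w.toFinsupp = c) :
    ∃ α : w.ι ≃ (SqMatrix.ofSum ε c).ι, (SqMatrix.ofSum ε c).mat.submatrix α α = w.diag u := by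
  obtain rfl : ε = _ := funext hε
  subst hw
  obtain ⟨α, hα⟩ := exists_equiv_comp_eq w.gen (Sigma.fst : (Σ x, Fin (w.toFinsupp x)) → X) <| by
    intro x
    rw [← w.toFinsupp_apply, Fintype.card_congr (Equiv.sigmaSubtype x), Fintype.card_fin]
  let M (p : Σ x, Fin (w.toFinsupp x)) : Matrix PUnit.{v + 1} PUnit.{v + 1} A := fun _ _ => u p.1
  refine ⟨α.trans (Equiv.sigmaPUnit _).symm, Matrix.ext fun k l => ?_⟩
  change Matrix.blockDiagonal' M ⟨α k, ⟨⟩⟩ ⟨α l, ⟨⟩⟩ = w.diag u k l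
  obtain rfl | h := eq_or_ne k l
  · simpa [LabeledSum.diag] using congrArg u (hα k)
  · simp [LabeledSum.diag, Matrix.blockDiagonal'_apply_ne, h]

namespace BergmanPresentation

theorem IsBasic.blueStage_ordering (K : Type u) [Field K] {X : Type v} [Fintype X] [DecidableEq X]
    {I : Type w} {P : BergmanPresentation X I} (hP : P.IsBasic) :
    P.blueStage K P.ordering = P.initialStage K := by
  have h : P.ordering = [] := List.eq_nil_iff_forall_not_mem.2 fun i hi => by
    simpa [hP.blue_eq_empty] using (P.exists_admissible.choose_spec.2.1 i).1 hi
  rw [h, blueStage, List.foldl_nil]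

theorem IsBasic.exists_isUniversal (K : Type u) [Field K] {X X' : Type v} [Fintype X]
    [DecidableEq X] [Fintype X'] {I J : Type w} {P : BergmanPresentation X I} (hP : P.IsBasic)
    (γ : X' ≃ X) (δ : J ≃ I) (a b : J → LabeledSum X')
    (ha : ∀ j, ((a j).map γ).toFinsupp = P.a (δ j))
    (hb : ∀ j, ((b j).map γ).toFinsupp = P.b (δ j)) :
    ∃ D : IsoSystem a b (P.algebra K), D.IsUniversal K := by
  suffices ∀ T, T = P.initialStage K → ∃ D : IsoSystem a b (P.redAlgebra K T), D.IsUniversal K from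
    this _ (hP.blueStage_ordering K)
  rintro _ rfl
  have := Fintype.ofFinite P.base
  have hmem x : x ∈ P.base := hP ▸ Set.mem_univ x
  have hε x : (P.initialStage K).ε x = ⟨PUnit, fun _ _ => Pi.single ⟨x, hmem x⟩ 1⟩ :=
    dif_pos (hmem x)
  choose α hα using fun j => SqMatrix.exists_submatrix_ofSum_eq_diag _ hε (ha j)
  choose β hβ using fun j => SqMatrix.exists_submatrix_ofSum_eq_diag _ hε (hb j)
  exact ⟨_, IsoExt.isUniversal_isoSystem K (γ.trans (Equiv.subtypeUnivEquiv hmem).symm)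
    (δ.trans (Equiv.subtypeUnivEquiv fun i => by simp [hP.blue_eq_empty]).symm) α β hα hβ⟩

end BergmanPresentation

/-! ### Representations -/

/-- A representation of the relations `a j = b j`: a `K`-module for every generator, and for every
relation an isomorphism between the direct sums corresponding to its two sides. -/
structure Rep (K : Type u) [CommRing K] {X : Type v} {J : Type w} (a b : J → LabeledSum X) where
  V : X → Type t
  [addCommGroup : ∀ x, AddCommGroup (V x)]
  [module : ∀ x, Module K (V x)]
  iso : ∀ j, (∀ k, V ((a j).gen k)) ≃ₗ[K] ∀ l, V ((b j).gen l)

namespace Rep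

attribute [instance] Rep.addCommGroup Rep.module

variable {K : Type u} [CommRing K] {X : Type v} {J : Type w} {a b : J → LabeledSum X}

/-- The families of linear maps which commute with the isomorphisms of two representations. -/
def homs (R S : Rep.{u, v, w, t} K a b) : Submodule K (∀ x, R.V x →ₗ[K] S.V x) where
  carrier := {f | ∀ j v, S.iso j (fun k => f _ (v k)) = fun l => f _ (R.iso j v l)}
  add_mem' hf hg j v := (map_add (S.iso j) _ _).trans (congrArg₂ (· + ·) (hf j v) (hg j v))
  zero_mem' j _ := map_zero (S.iso j)
  smul_mem' c _ hf j v := (map_smul (S.iso j) c _).trans (congrArg (c • ·) (hf j v))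

instance : Category (Rep.{u, v, w, t} K a b) where
  Hom R S := R.homs S
  id R := ⟨fun _ => LinearMap.id, fun _ _ => rfl⟩
  comp {R S T} f g := ⟨fun x => g.1 x ∘ₗ f.1 x, fun j v =>
    (g.2 j _).trans (funext fun l => congrArg (g.1 _) (congrFun (f.2 j v) l))⟩

instance (R S : Rep.{u, v, w, t} K a b) : AddCommGroup (R ⟶ S) :=
  inferInstanceAs (AddCommGroup (R.homs S))

instance (R S : Rep.{u, v, w, t} K a b) : Module K (R ⟶ S) :=
  inferInstanceAs (Module K (R.homs S))

theorem hom_ext {R S : Rep.{u, v, w, t} K a b} {f g : R ⟶ S} (h : ∀ x n, f.1 x n = g.1 x n) :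
    f = g :=
  Subtype.ext (funext fun x => LinearMap.ext (h x))

instance : Preadditive (Rep.{u, v, w, t} K a b) where
  add_comp _ _ _ f g h := hom_ext fun x n => map_add (h.1 x) (f.1 x n) (g.1 x n)
  comp_add _ _ _ _ _ _ := rfl

instance : Linear K (Rep.{u, v, w, t} K a b) where
  smul_comp _ _ _ c f h := hom_ext fun x n => map_smul (h.1 x) c (f.1 x n)
  comp_smul _ _ _ _ _ _ := rfl

/-- The isomorphism of representations given by a compatible family of linear isomorphisms. -/
def isoOfLinearEquiv {R S : Rep.{u, v, w, t} K a b} (e : ∀ x, R.V x ≃ₗ[K] S.V x)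
    (he : ∀ j v, S.iso j (fun k => e _ (v k)) = fun l => e _ (R.iso j v l)) : R ≅ S where
  hom := ⟨fun x => e x, he⟩
  inv := ⟨fun x => (e x).symm, fun j v => by
    have h := he j fun k => (e _).symm (v k)
    simp only [LinearEquiv.apply_symm_apply] at h
    funext l
    simp [h]⟩
  hom_inv_id := hom_ext fun x n => (e x).symm_apply_apply n
  inv_hom_id := hom_ext fun x n => (e x).apply_symm_apply n

end Rep

/-! ### The representation defined by a module -/

section Part

variable (K : Type u) [CommRing K] {B : Type*} [Ring B] [Algebra K B] (M : Type*) [AddCommGroup M]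
  [Module K M] [Module B M] [IsScalarTower K B M]

/-- The summand `c • M` of a `B`-module `M`, where `c` is an idempotent of `B`, encoded as the set
of elements fixed by `c`. -/
def part (c : B) : Submodule K M :=
  LinearMap.eqLocus (Algebra.lsmul K K M c) LinearMap.id

variable {M}

theorem smul_mem_part {b c : B} (h : c * b = b) (m : M) : b • m ∈ part K M c :=
  (smul_smul c b m).trans (congrArg (· • m) h)

@[simp]
theorem smul_coe_part {c : B} (m : part K M c) : c • (m : M) = m :=
  m.2

/-- The projection of a module onto its summand given by an idempotent. -/
def toPart {c : B} (hc : IsIdempotentElem c) : M →ₗ[K] part K M c :=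
  (Algebra.lsmul K K M c).codRestrict _ (smul_mem_part K hc)

@[simp]
theorem toPart_apply_coe {c : B} (hc : IsIdempotentElem c) (m : M) :
    (toPart K hc m : M) = c • m :=
  rfl

theorem toPart_coe {c : B} (hc : IsIdempotentElem c) (m : part K M c) : toPart K hc (m : M) = m :=
  Subtype.ext m.2

theorem smul_coe_part_of_mul_eq_zero {b c : B} (h : b * c = 0) (m : part K M c) :
    b • (m : M) = 0 := by
  rw [← smul_coe_part K m, smul_smul, h, zero_smul]

theorem exists_linearMap_extending {N : Type*} [AddCommGroup N] [Module K N] [Module B N]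
    [IsScalarTower K B N] {X : Type*} [Fintype X] {e : X → B} (he : CompleteOrthogonalIdempotents e)
    (γ : ∀ x, part K M (e x) →ₗ[K] part K N (e x)) :
    ∃ f : M →ₗ[K] N, (∀ x (m : part K M (e x)), f m = γ x m) ∧
      ∀ x m, f (e x • m) = e x • f m := by
  classical
  let f : M →ₗ[K] N := ∑ x, (part K N (e x)).subtype ∘ₗ γ x ∘ₗ toPart K (he.idem x)
  have hf m : f m = ∑ x, (γ x (toPart K (he.idem x) m) : N) := by simp [f]
  have hfx x (m : part K M (e x)) : f m = γ x m := by
    rw [hf, Finset.sum_eq_single x (fun y _ hy => ?_) (by simp), toPart_coe]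
    have h : toPart K (he.idem y) (m : M) = 0 :=
      Subtype.ext (smul_coe_part_of_mul_eq_zero K (he.ortho hy) m)
    rw [h, map_zero, Submodule.coe_zero]
  refine ⟨f, hfx, fun x m => ?_⟩
  rw [← toPart_apply_coe K (he.idem x), hfx, hf, Finset.smul_sum,
    Finset.sum_eq_single x (fun y _ hy => ?_) (by simp), smul_coe_part]
  exact smul_coe_part_of_mul_eq_zero K (he.ortho hy.symm) _

end Part

namespace MatrixIso

variable {B : Type*} [Ring B] {ι κ : Type*} [Fintype ι] [Fintype κ]

theorem mul_τ {Z : Matrix ι ι B} {H : Matrix κ κ B} (F : MatrixIso Z H)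
    (hH : IsIdempotentElem H) : H * F.τ = F.τ := by
  rw [← F.corner_symm, ← Matrix.mul_assoc, ← Matrix.mul_assoc, hH.eq]

theorem τ_mul {Z : Matrix ι ι B} {H : Matrix κ κ B} (F : MatrixIso Z H)
    (hZ : IsIdempotentElem Z) : F.τ * Z = F.τ := by
  rw [← F.corner_symm, Matrix.mul_assoc, hZ.eq]

variable [DecidableEq ι] [DecidableEq κ] {p : ι → B} {q : κ → B}
  (F : MatrixIso (Matrix.diagonal p) (Matrix.diagonal q))

theorem mul_τ_apply (hq : IsIdempotentElem q) (l : κ) (k : ι) : q l * F.τ l k = F.τ l k := by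
  simpa using congrFun₂ (F.mul_τ (hq.map (Matrix.diagonalRingHom κ B))) l k

theorem τ_mul_apply (hp : IsIdempotentElem p) (l : κ) (k : ι) : F.τ l k * p k = F.τ l k := by
  simpa using congrFun₂ (F.τ_mul (hp.map (Matrix.diagonalRingHom ι B))) l k

variable (K : Type u) [CommRing K] [Algebra K B] (M : Type*) [AddCommGroup M] [Module K M]
  [Module B M] [IsScalarTower K B M]

/-- The linear map between the sums of the summands of a module which `F.τ` defines. -/
def partMap (hq : IsIdempotentElem q) : (∀ k, part K M (p k)) →ₗ[K] ∀ l, part K M (q l) :=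
  LinearMap.pi fun l => LinearMap.codRestrict _
    (∑ k, Algebra.lsmul K K M (F.τ l k) ∘ₗ Submodule.subtype _ ∘ₗ LinearMap.proj k) fun v => by
      simpa using Submodule.sum_mem _ fun k _ => smul_mem_part K (F.mul_τ_apply hq l k) (v k : M)

@[simp]
theorem coe_partMap (hq : IsIdempotentElem q) (v : ∀ k, part K M (p k)) (l : κ) :
    (F.partMap K M hq v l : M) = ∑ k, F.τ l k • (v k : M) := by
  simp [partMap]

theorem symm_partMap_partMap (hp : IsIdempotentElem p) (hq : IsIdempotentElem q)
    (v : ∀ k, part K M (p k)) : F.symm.partMap K M hp (F.partMap K M hq v) = v := by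
  ext k
  calc (F.symm.partMap K M hp (F.partMap K M hq v) k : M)
    _ = ∑ k', (F.σ * F.τ) k k' • (v k' : M) := by
      simp only [coe_partMap, symm_τ, Finset.smul_sum, smul_smul, Matrix.mul_apply, Finset.sum_smul]
      exact Finset.sum_comm
    _ = v k := by simp [F.mul_symm, Matrix.diagonal_apply, ite_smul]

/-- The isomorphism between the sums of the summands of a module which `F` defines. -/
def partEquiv (hp : IsIdempotentElem p) (hq : IsIdempotentElem q) :
    (∀ k, part K M (p k)) ≃ₗ[K] ∀ l, part K M (q l) :=
  .ofLinearMap (F.partMap K M hq) (F.symm.partMap K M hp)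
    (LinearMap.ext (F.symm.symm_partMap_partMap K M hq hp))
    (LinearMap.ext (F.symm_partMap_partMap K M hp hq))

variable {M} {N : Type*} [AddCommGroup N] [Module K N] [Module B N]

theorem map_τ_smul (hp : IsIdempotentElem p) (hq : IsIdempotentElem q) {f : M →ₗ[K] N}
    (hf : ∀ k m, f (p k • m) = p k • f m)
    (h : ∀ v l, f (F.partMap K M hq v l) = ∑ k, F.τ l k • f (v k)) (l : κ) (k : ι) (m : M) :
    f (F.τ l k • m) = F.τ l k • f m := by
  have hpk : IsIdempotentElem (p k) := congrFun hp k
  have hk := h (Pi.single k (toPart K hpk m)) l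
  rw [coe_partMap, Finset.sum_eq_single k (by simp +contextual) (by simp),
    Finset.sum_eq_single k (by simp +contextual) (by simp)] at hk
  simpa only [Pi.single_eq_same, toPart_apply_coe, Algebra.lsmul_coe, hf, smul_smul,
    F.τ_mul_apply hp] using hk

end MatrixIso

namespace IsoSystem

variable {X : Type v} [Fintype X] {J : Type w} {a b : J → LabeledSum X} {B : Type*} [Ring B]
  (D : IsoSystem a b B)

theorem isIdempotentElem_comp_gen (w : LabeledSum X) : IsIdempotentElem (D.e ∘ w.gen) :=
  funext fun k => D.complete.idem (w.gen k)

variable (K : Type u) [CommRing K] [Algebra K B]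

section Part

variable (M : Type*) [AddCommGroup M] [Module K M] [Module B M] [IsScalarTower K B M]

/-- The isomorphism which a system defines between the sums of the summands of a module that
correspond to the two sides of a relation. -/
def partEquiv (j : J) :
    (∀ k, part K M (D.e ((a j).gen k))) ≃ₗ[K] ∀ l, part K M (D.e ((b j).gen l)) :=
  (D.iso j).partEquiv K M (D.isIdempotentElem_comp_gen _) (D.isIdempotentElem_comp_gen _)

@[simp]
theorem coe_partEquiv (j : J) (v : ∀ k, part K M (D.e ((a j).gen k))) (l : (b j).ι) :
    (D.partEquiv K M j v l : M) = ∑ k, (D.iso j).τ l k • (v k : M) :=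
  (D.iso j).coe_partMap K M (D.isIdempotentElem_comp_gen _) v l

end Part

section Functor

open scoped ModuleCat.Algebra

/-- The functor which maps a `B`-module `M` to the representation with the modules `e x • M`. -/
def toRep : ModuleCat.{t} B ⥤ Rep.{u, v, w, t} K a b where
  obj M := ⟨fun x => part K M (D.e x), D.partEquiv K M⟩
  map {M N} f :=
    ⟨fun x => (f.hom.restrictScalars K).restrict fun m hm =>
      (map_smul f.hom (D.e x) m).symm.trans (congrArg f.hom hm),
    fun j v => funext fun l => Subtype.ext <| by
      rw [coe_partEquiv]
      refine Eq.trans ?_ (congrArg f.hom (D.coe_partEquiv K M j v l).symm)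
      rw [map_sum]
      exact Finset.sum_congr rfl fun k _ => (map_smul f.hom _ _).symm⟩

instance : (D.toRep K).Additive where

instance : (D.toRep K).Linear K where

instance : (D.toRep K).Faithful where
  map_injective {M N} f g h := by
    ext m
    have hx x : f.hom (D.e x • m) = g.hom (D.e x • m) :=
      congrArg (fun φ => (φ.1 x (toPart K (D.complete.idem x) m)).1) h
    rw [← one_smul B m, ← D.complete.complete, Finset.sum_smul, map_sum, map_sum]
    exact Finset.sum_congr rfl fun x _ => hx x

end Functor

section Hom

variable {K} {M N : Type*} [AddCommGroup M] [Module K M] [Module B M] [IsScalarTower K B M]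
  [AddCommGroup N] [Module K N] [Module B N] [IsScalarTower K B N]

theorem map_τ_smul {γ : ∀ x, part K M (D.e x) →ₗ[K] part K N (D.e x)} {f : M →ₗ[K] N}
    (hfγ : ∀ x (m : part K M (D.e x)), f m = γ x m) (hfe : ∀ x m, f (D.e x • m) = D.e x • f m)
    {j : J}
    (hγ : ∀ v, D.partEquiv K N j (fun k => γ _ (v k)) = fun l => γ _ (D.partEquiv K M j v l))
    (l : (b j).ι) (k : (a j).ι) (m : M) :
    f ((D.iso j).τ l k • m) = (D.iso j).τ l k • f m := by
  refine (D.iso j).map_τ_smul K (D.isIdempotentElem_comp_gen _) (D.isIdempotentElem_comp_gen _)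
    (fun _ => hfe _) (fun v l => ?_) l k m
  calc f (D.partEquiv K M j v l)
    _ = D.partEquiv K N j (fun k => γ _ (v k)) l := by rw [hfγ, hγ]
    _ = ∑ k, (D.iso j).τ l k • f (v k) := by
      rw [coe_partEquiv]
      exact Finset.sum_congr rfl fun k _ => congrArg _ (hfγ _ (v k)).symm

variable {D}

theorem IsUniversal.map_smul (hD : D.IsUniversal K) {f : M →ₗ[K] N}
    (he : ∀ x m, f (D.e x • m) = D.e x • f m)
    (hσ : ∀ j k l m, f ((D.iso j).σ k l • m) = (D.iso j).σ k l • f m)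
    (hτ : ∀ j l k m, f ((D.iso j).τ l k • m) = (D.iso j).τ l k • f m) (c : B) (m : M) :
    f (c • m) = c • f m := by
  let S : Subalgebra K B :=
    { carrier := {c | ∀ m, f (c • m) = c • f m}
      mul_mem' := fun hb hc m => by rw [mul_smul, hb, hc, mul_smul]
      add_mem' := fun hb hc m => by rw [add_smul, map_add, hb, hc, add_smul]
      algebraMap_mem' := fun c m => by simp }
  exact (hD.eq_top S he hσ hτ).ge Algebra.mem_top m

theorem IsUniversal.exists_linearMap_extending (hD : D.IsUniversal K)
    (γ : ∀ x, part K M (D.e x) →ₗ[K] part K N (D.e x))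
    (hγ : ∀ j v, D.partEquiv K N j (fun k => γ _ (v k)) = fun l => γ _ (D.partEquiv K M j v l)) :
    ∃ f : M →ₗ[B] N, ∀ x (m : part K M (D.e x)), f m = γ x m := by
  obtain ⟨f, hfγ, hfe⟩ := Bergman.exists_linearMap_extending K D.complete γ
  have hγ_symm j v : D.symm.partEquiv K N j (fun l => γ _ (v l)) =
      fun k => γ _ (D.symm.partEquiv K M j v k) :=
    (LinearEquiv.symm_apply_eq (D.partEquiv K N j)).2 <| .symm <| (hγ j _).trans <|
      funext fun l => congrArg (γ _) (congrFun ((D.partEquiv K M j).apply_symm_apply v) l)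
  exact ⟨{ f with
    map_smul' := hD.map_smul hfe (fun j => D.symm.map_τ_smul hfγ hfe (hγ_symm j))
      fun j => D.map_τ_smul hfγ hfe (hγ j) }, hfγ⟩

end Hom

open scoped ModuleCat.Algebra

variable {D K}

theorem IsUniversal.full_toRep (hD : D.IsUniversal K) : (D.toRep.{u, v, w, t} K).Full where
  map_surjective g :=
    have ⟨f, hf⟩ := hD.exists_linearMap_extending g.1 g.2
    ⟨ModuleCat.ofHom f, Rep.hom_ext fun x m => Subtype.ext (hf x m)⟩

end IsoSystem

/-! ### The module defined by a representation -/

section Block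

variable {K : Type u} [CommRing K] {X : Type v} [DecidableEq X] {V : X → Type t}
  [∀ x, AddCommGroup (V x)] [∀ x, Module K (V x)]

variable (K V) in
/-- The projection of the product of the modules `V x` onto its factor with index `x`. -/
def projEnd (x : X) : Module.End K (∀ x, V x) :=
  LinearMap.single K V x ∘ₗ LinearMap.proj x

@[simp]
theorem projEnd_apply (x : X) (v : ∀ x, V x) : projEnd K V x v = Pi.single x (v x) :=
  rfl

variable (K V) in
theorem completeOrthogonalIdempotents_projEnd [Fintype X] :
    CompleteOrthogonalIdempotents (projEnd K V) where
  idem x := LinearMap.ext fun v => by simp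
  ortho x y h := LinearMap.ext fun v => by simp [h]
  complete := LinearMap.ext fun v => by simp [Finset.univ_sum_single]

variable {ι κ μ : Type*} [DecidableEq ι] {p : ι → X} {q : κ → X} {r : μ → X}

/-- The matrix of a linear map between products of modules `V x`; its entries are linear maps
between the factors, regarded as endomorphisms of `∀ x, V x`. -/
def blockMatrix (f : (∀ k, V (p k)) →ₗ[K] ∀ l, V (q l)) :
    Matrix κ ι (Module.End K (∀ x, V x)) :=
  fun l k => LinearMap.single K V (q l) ∘ₗ LinearMap.proj l ∘ₗ f ∘ₗ
    LinearMap.single K (fun k => V (p k)) k ∘ₗ LinearMap.proj (p k)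

@[simp]
theorem blockMatrix_apply (f : (∀ k, V (p k)) →ₗ[K] ∀ l, V (q l)) (l : κ) (k : ι) (v : ∀ x, V x) :
    blockMatrix f l k v = Pi.single (q l) (f (Pi.single k (v (p k))) l) :=
  rfl

theorem sum_blockMatrix_apply_single [Fintype ι] (f : (∀ k, V (p k)) →ₗ[K] ∀ l, V (q l)) (l : κ)
    (v : ∀ k, V (p k)) :
    ∑ k, blockMatrix f l k (Pi.single (p k) (v k)) = Pi.single (q l) (f v l) := by
  have h : f v l = ∑ k, f (Pi.single k (v k)) l := by
    rw [← Finset.sum_apply, ← map_sum, Finset.univ_sum_single]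
  simp only [blockMatrix_apply, Pi.single_eq_same, h]
  exact (map_sum (LinearMap.single K V (q l)) _ _).symm

theorem blockMatrix_comp [Fintype κ] [DecidableEq κ] (g : (∀ l, V (q l)) →ₗ[K] ∀ m, V (r m))
    (f : (∀ k, V (p k)) →ₗ[K] ∀ l, V (q l)) :
    blockMatrix (g ∘ₗ f) = blockMatrix g * blockMatrix f := by
  ext1 m k
  refine LinearMap.ext fun v => ?_
  rw [Matrix.mul_apply, LinearMap.sum_apply]
  exact (sum_blockMatrix_apply_single g m (f (Pi.single k (v (p k))))).symm

theorem blockMatrix_id : blockMatrix (LinearMap.id : (∀ k, V (p k)) →ₗ[K] _) =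
    Matrix.diagonal (projEnd K V ∘ p) := by
  ext1 l k
  refine LinearMap.ext fun v => ?_
  obtain rfl | h := eq_or_ne l k <;> simp [*]

/-- The isomorphism between idempotent matrices which corresponds to an isomorphism between products
of modules `V x`. -/
def blockMatrixIso [Fintype ι] [Fintype κ] [DecidableEq κ] (f : (∀ k, V (p k)) ≃ₗ[K] ∀ l, V (q l)) :
    MatrixIso (Matrix.diagonal (projEnd K V ∘ p)) (Matrix.diagonal (projEnd K V ∘ q)) where
  σ := blockMatrix f.symm.toLinearMap
  τ := blockMatrix f.toLinearMap
  corner := by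
    simp only [← blockMatrix_id, ← blockMatrix_comp, LinearMap.comp_id, LinearMap.id_comp]
  corner_symm := by
    simp only [← blockMatrix_id, ← blockMatrix_comp, LinearMap.comp_id, LinearMap.id_comp]
  mul_symm := by rw [← blockMatrix_id, ← blockMatrix_comp, LinearEquiv.symm_comp]
  symm_mul := by rw [← blockMatrix_id, ← blockMatrix_comp, LinearEquiv.comp_symm]

end Block

section EssSurj

variable {K : Type u} [CommRing K] {X : Type v} [Fintype X] [DecidableEq X] {J : Type w}
  {a b : J → LabeledSum X}

/-- The system of endomorphisms of the product of the modules of a representation. -/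
def Rep.endSystem (R : Rep.{u, v, w, t} K a b) : IsoSystem a b (Module.End K (∀ x, R.V x)) where
  e := projEnd K R.V
  complete := completeOrthogonalIdempotents_projEnd K R.V
  iso j := blockMatrixIso (R.iso j)

variable {B : Type*} [Ring B] [Algebra K B]

/-- If the product of the modules `V x` is a `B`-module on which `e x` acts as the projection onto
`V x`, then `e x • ∀ x, V x` is `V x`. -/
def equivPart {V : X → Type t} [∀ x, AddCommGroup (V x)] [∀ x, Module K (V x)] {M : Type*}
    [AddCommGroup M] [Module K M] [Module B M] [IsScalarTower K B M] (ψ : (∀ x, V x) ≃ₗ[K] M)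
    {e : X → B} (he : ∀ x v, e x • ψ v = ψ (projEnd K V x v)) (x : X) :
    V x ≃ₗ[K] part K M (e x) where
  __ := (ψ.toLinearMap ∘ₗ LinearMap.single K V x).codRestrict _ fun n => (he x _).trans (by simp)
  invFun m := ψ.symm m x
  left_inv n := (congrFun (ψ.symm_apply_apply _) x).trans (Pi.single_eq_same x n)
  right_inv m := Subtype.ext <| (he x (ψ.symm m)).symm.trans <|
    (congrArg _ (ψ.apply_symm_apply _)).trans m.2

open scoped ModuleCat.Algebra

/-- The `B`-module on which `B` acts through a homomorphism to the endomorphisms of a `K`-module. -/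
def moduleOfAlgHom {V : Type t} [AddCommGroup V] [Module K V] (f : B →ₐ[K] Module.End K V) :
    ModuleCat.{t} B :=
  letI := Module.compHom V f.toRingHom
  .of B V

theorem exists_linearEquiv_moduleOfAlgHom {V : Type t} [AddCommGroup V] [Module K V]
    (f : B →ₐ[K] Module.End K V) :
    ∃ ψ : V ≃ₗ[K] moduleOfAlgHom f, ∀ c v, c • ψ v = ψ (f c v) :=
  let ψ : V ≃+ moduleOfAlgHom f := AddEquiv.refl V
  ⟨ψ.toLinearEquiv fun c v => (congrArg (· v) (f.commutes c)).symm, fun _ _ => rfl⟩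

namespace IsoSystem

variable {D : IsoSystem a b B}

/-- If the product of the modules of a representation `R` is a `B`-module on which `D` acts as the
system of endomorphisms `R.endSystem`, then `R` is the representation defined by this module. -/
def isoToRepObj {R : Rep.{u, v, w, t} K a b} {M : ModuleCat.{t} B} (ψ : (∀ x, R.V x) ≃ₗ[K] M)
    (he : ∀ x v, D.e x • ψ v = ψ (R.endSystem.e x v))
    (hτ : ∀ j l k v, (D.iso j).τ l k • ψ v = ψ ((R.endSystem.iso j).τ l k v)) :
    R ≅ (D.toRep K).obj M :=
  Rep.isoOfLinearEquiv (equivPart ψ he) fun j v => funext fun l => Subtype.ext <| by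
    calc _
      _ = ∑ k, (D.iso j).τ l k • (equivPart ψ he _ (v k) : M) := D.coe_partEquiv K M j _ l
      _ = ∑ k, ψ (blockMatrix (R.iso j).toLinearMap l k (Pi.single _ (v k))) :=
        Finset.sum_congr rfl fun k _ => hτ j l k _
      _ = ψ (Pi.single ((b j).gen l) (R.iso j v l)) := by
        rw [← map_sum, sum_blockMatrix_apply_single]; rfl

omit [DecidableEq X] in
theorem IsUniversal.essSurj_toRep (hD : D.IsUniversal K) :
    (D.toRep.{u, v, w, max u v w} K).EssSurj where
  mem_essImage R := by
    classical
    obtain ⟨f, hfe, -, hfτ⟩ := hD.exists_lift R.endSystem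
    obtain ⟨ψ, hψ⟩ := exists_linearEquiv_moduleOfAlgHom f
    exact ⟨moduleOfAlgHom f, ⟨(isoToRepObj ψ (fun x v => by rw [hψ, hfe])
      fun j l k v => by rw [hψ, hfτ]).symm⟩⟩

omit [DecidableEq X] in
theorem IsUniversal.isEquivalence_toRep (hD : D.IsUniversal K) :
    (D.toRep.{u, v, w, max u v w} K).IsEquivalence where
  full := hD.full_toRep
  essSurj := hD.essSurj_toRep

end IsoSystem

end EssSurj

/-! ### Eliminating a generator -/

namespace LabeledSum

section BindEquiv

variable {K : Type u} [CommRing K] {X Y : Type v} {s : X → LabeledSum Y} {V : X → Type*}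
  {W : Y → Type*} [∀ x, AddCommGroup (V x)] [∀ x, Module K (V x)] [∀ y, AddCommGroup (W y)]
  [∀ y, Module K (W y)]

/-- The isomorphism between the direct sums that correspond to `w.bind s` and to `w` if every
generator `x` stands for the direct sum that corresponds to `s x`. -/
def bindEquiv (E : ∀ x, (∀ m, W ((s x).gen m)) ≃ₗ[K] V x) (w : LabeledSum X) :
    (∀ p, W ((w.bind s).gen p)) ≃ₗ[K] ∀ k, V (w.gen k) :=
  LinearEquiv.piCurry K (fun k m => W ((s (w.gen k)).gen m)) ≪≫ₗ
    LinearEquiv.piCongrRight fun k => E (w.gen k)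

end BindEquiv

variable {Y : Type v} {J : Type w}

/-- The substitution of `c` for the generator `none`. -/
@[simp] def substNone (c : LabeledSum Y) (x : Option Y) : LabeledSum Y :=
  x.elim c pure

/-- The left hand sides of the relations `a j = b j` and `none = c`. -/
def consLeft (a : J → LabeledSum (Option Y)) (j : Option J) : LabeledSum (Option Y) :=
  j.elim (pure none) a

/-- The right hand sides of the relations `a j = b j` and `none = c`. -/
def consRight (c : LabeledSum Y) (b : J → LabeledSum (Option Y)) (j : Option J) :
    LabeledSum (Option Y) :=
  j.elim (c.map some) b

/-- The sides of the relations in which `c` has been substituted for the generator `none`. -/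
abbrev elimNone (c : LabeledSum Y) (a : J → LabeledSum (Option Y)) (j : J) : LabeledSum Y :=
  (a j).bind c.substNone

end LabeledSum

open LabeledSum

namespace Rep

variable {K : Type u} [CommRing K] {Y : Type v} {J : Type w} {c : LabeledSum Y}
  {a b : J → LabeledSum (Option Y)}

/-- The representation in which `none` stands for the direct sum that corresponds to `c`. -/
def extendObj (N : Rep.{u, v, w, t} K (c.elimNone a) (c.elimNone b)) :
    Rep.{u, v, w, max v t} K (consLeft a) (consRight c b) where
  V x := ∀ m, N.V ((c.substNone x).gen m)
  iso
    | none => .piUnique K (fun _ : PUnit.{v + 1} => ∀ m, N.V (c.gen m)) ≪≫ₗ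
      .piCongrRight fun m => (LinearEquiv.piUnique K (fun _ : PUnit.{v + 1} => N.V (c.gen m))).symm
    | some j =>
      let E (x : Option Y) := LinearEquiv.refl K (∀ m, N.V ((c.substNone x).gen m))
      (bindEquiv E (a j)).symm ≪≫ₗ N.iso j ≪≫ₗ bindEquiv E (b j)

/-- In a representation of `none = c`, the module of `none` is the direct sum that corresponds to
`c`. -/
def substEquiv (R : Rep.{u, v, w, t} K (consLeft a) (consRight c b)) :
    ∀ x, (∀ m, R.V (some ((c.substNone x).gen m))) ≃ₗ[K] R.V x
  | none => (R.iso none).symm ≪≫ₗ .piUnique K fun _ : PUnit.{v + 1} => R.V none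
  | some y => .piUnique K fun _ : PUnit.{v + 1} => R.V (some y)

/-- The functor which extends representations to an additional generator `none` that is equal to a
sum `c` of the other generators. -/
def extend : Rep.{u, v, w, t} K (c.elimNone a) (c.elimNone b) ⥤
    Rep.{u, v, w, max v t} K (consLeft a) (consRight c b) where
  obj := extendObj
  map f := ⟨fun x => .piMap fun m => f.1 ((c.substNone x).gen m), fun
    | none, _ => rfl
    | some j, v => funext fun k => funext fun m => congrFun (f.2 j fun p => v p.1 p.2) ⟨k, m⟩⟩

instance : (extend (K := K) (a := a) (b := b) (c := c)).Additive where

instance : (extend (K := K) (a := a) (b := b) (c := c)).Linear K where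

instance : (extend (K := K) (a := a) (b := b) (c := c)).Faithful where
  map_injective h := hom_ext fun y n =>
    congrFun (congrArg (fun φ => φ.1 (some y) fun _ : PUnit => n) h) ⟨⟩

theorem apply_of_extend {N N' : Rep.{u, v, w, t} K (c.elimNone a) (c.elimNone b)}
    (g : extend.obj N ⟶ extend.obj N') (x : Option Y) (v : ∀ m, N.V ((c.substNone x).gen m)) (m) :
    g.1 x v m = g.1 (some ((c.substNone x).gen m)) (fun _ => v m) PUnit.unit := by
  cases x with
  | none => exact congrFun (congrFun (g.2 none fun _ => v) m) PUnit.unit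
  | some y => rfl

instance : (extend (K := K) (a := a) (b := b) (c := c)).Full where
  map_surjective {N N'} g := by
    let f (y : Y) : N.V y →ₗ[K] N'.V y :=
      { toFun := fun n => g.1 (some y) (fun _ => n) PUnit.unit
        map_add' := fun n n' =>
          congrFun (map_add (g.1 (some y)) (fun _ => n) fun _ => n') PUnit.unit
        map_smul' := fun r n => congrFun (map_smul (g.1 (some y)) r fun _ => n) PUnit.unit }
    have hf x (v : ∀ m, N.V ((c.substNone x).gen m)) : g.1 x v = fun m => f _ (v m) :=
      funext (apply_of_extend g x v)
    refine ⟨⟨f, fun j v => funext fun l => ?_⟩, hom_ext fun x v => (hf x v).symm⟩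
    have h := (congrArg ((extendObj N').iso (some j)) (funext fun k => (hf _ _).symm)).trans
      (g.2 (some j) fun k m => v ⟨k, m⟩)
    exact (congrFun (congrFun h l.1) l.2).trans (congrFun (hf _ _) l.2)

/-- The restriction of a representation to the generators different from `none`. -/
def restrictObj (R : Rep.{u, v, w, t} K (consLeft a) (consRight c b)) :
    Rep.{u, v, w, t} K (c.elimNone a) (c.elimNone b) where
  V y := R.V (some y)
  iso j := bindEquiv (V := R.V) (W := fun y => R.V (some y)) R.substEquiv (a j) ≪≫ₗ
    R.iso (some j) ≪≫ₗ (bindEquiv (W := fun y => R.V (some y)) R.substEquiv (b j)).symm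

/-- A representation is determined by its restriction. -/
def extendRestrictIso (R : Rep.{u, v, w, max v t} K (consLeft a) (consRight c b)) :
    extend.{u, v, w, max v t}.obj R.restrictObj ≅ R :=
  isoOfLinearEquiv R.substEquiv fun
    | none, v => (R.iso none).apply_symm_apply (v PUnit.unit)
    | some j, _ => .symm <|
      (bindEquiv (V := R.V) (W := fun y => R.V (some y)) R.substEquiv (b j)).apply_symm_apply _

theorem isEquivalence_extend :
    (extend.{u, v, w, max v t} (K := K) (a := a) (b := b) (c := c)).IsEquivalence where
  essSurj := ⟨fun R => ⟨R.restrictObj, ⟨R.extendRestrictIso⟩⟩⟩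

end Rep

/-! ### Collapsing a presentation -/

open scoped ModuleCat.Algebra in
theorem isMoritaEquivalent_of_isEquivalence {K : Type u} [CommRing K] {A : Type v} {B : Type w}
    [Ring A] [Algebra K A] [Ring B] [Algebra K B] {C : Type*} [Category* C] [Preadditive C]
    [Linear K C] (F : ModuleCat.{max v w} A ⥤ C) (G : ModuleCat.{max v w} B ⥤ C)
    [F.Linear K] [G.Additive] [G.Linear K] [F.IsEquivalence] [G.IsEquivalence] :
    IsMoritaEquivalent K A B := by
  have : G.asEquivalence.functor.Additive := ‹G.Additive›
  have : G.asEquivalence.functor.Linear K := ‹G.Linear K›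
  have : G.asEquivalence.symm.functor.Linear K := G.asEquivalence.inverseLinear K
  exact ⟨⟨{
    eqv := F.asEquivalence.trans G.asEquivalence.symm
    linear := inferInstanceAs ((F ⋙ G.asEquivalence.symm.functor).Linear K) }⟩⟩

theorem isMoritaEquivalent_of_isUniversal {K : Type u} [CommRing K] {Y : Type v} [Fintype Y]
    {J : Type w} {c : LabeledSum Y} {a b : J → LabeledSum (Option Y)}
    {B B' : Type max u v w} [Ring B] [Algebra K B] [Ring B'] [Algebra K B']
    {D : IsoSystem (consLeft a) (consRight c b) B} (hD : D.IsUniversal K)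
    {D' : IsoSystem (c.elimNone a) (c.elimNone b) B'} (hD' : D'.IsUniversal K) :
    IsMoritaEquivalent K B' B := by
  have := hD.isEquivalence_toRep
  have := hD'.isEquivalence_toRep
  have := Rep.isEquivalence_extend.{u, v, w, max u v w} (K := K) (a := a) (b := b) (c := c)
  exact isMoritaEquivalent_of_isEquivalence
    (D'.toRep.{u, v, w, max u v w} K ⋙ Rep.extend.{u, v, w, max u v w})
    (D.toRep.{u, v, w, max u v w} K)

theorem mapDomain_val_subtypeDomain_ne {X : Type*} {x : X} {b : X →₀ ℕ} (hx : b x = 0) :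
    (b.subtypeDomain (· ≠ x)).mapDomain Subtype.val = b := by
  ext y
  by_cases hy : y = x
  · rw [Finsupp.mapDomain_of_notMem_range _ _ (by simpa using hy), hy, hx]
  · exact Finsupp.mapDomain_apply Subtype.val_injective _ (⟨y, hy⟩ : {y // y ≠ x})

theorem LabeledSum.toFinsupp_map_some {X : Type v} [DecidableEq X] {x : X} {b : X →₀ ℕ}
    {c : LabeledSum {y // y ≠ x}} (hc : c.toFinsupp = b.subtypeDomain (· ≠ x)) (hx : b x = 0) :
    ((c.map some).map (Equiv.optionSubtypeNe x)).toFinsupp = b := by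
  rw [toFinsupp_map, toFinsupp_map, ← Finsupp.mapDomain_comp, hc]
  exact mapDomain_val_subtypeDomain_ne hx

theorem LabeledSum.toFinsupp_bind_substNone {X : Type v} [DecidableEq X] {x : X} {b : X →₀ ℕ}
    {c : LabeledSum {y // y ≠ x}} (hc : c.toFinsupp = b.subtypeDomain (· ≠ x)) (w : LabeledSum X) :
    ((w.map (Equiv.optionSubtypeNe x).symm).bind c.substNone).toFinsupp =
      collapseSum x b w.toFinsupp := by
  rw [collapseSum, substitute, Finsupp.subtypeDomain_finsupp_sum, toFinsupp_bind, toFinsupp_map,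
    Finsupp.sum_mapDomain_index (by simp) (by simp [add_smul])]
  refine Finsupp.sum_congr fun y _ => Finsupp.ext fun u => ?_
  obtain rfl | hy := eq_or_ne y x
  · simp [hc]
  · simp [hy, Finsupp.single_apply, Subtype.ext_iff]

namespace BergmanPresentation

variable {X : Type v} {I : Type w} [DecidableEq X]

theorem isBasic_collapse (P : BergmanPresentation X I) (hP : P.IsBasic) (x : X) (i : I)
    (hx : P.b i x = 0) : (P.collapse hP x i hx).IsBasic := by
  refine Set.eq_univ_of_forall fun y j hj => ?_
  have : j.1 ∈ P.blue := hj
  simp [hP.blue_eq_empty] at this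

theorem isMoritaEquivalent_collapse (K : Type u) [Field K] [Fintype X]
    (P : BergmanPresentation X I) (hP : P.IsBasic) (x : X) (i : I)
    (hi : P.a i = Finsupp.single x 1) (hx : P.b i x = 0) :
    IsMoritaEquivalent K ((P.collapse hP x i hx).algebra K) (P.algebra K) := by
  classical
  let γ := Equiv.optionSubtypeNe x
  let c := ofFinsupp ((P.b i).subtypeDomain (· ≠ x))
  have hc : c.toFinsupp = (P.b i).subtypeDomain (· ≠ x) := toFinsupp_ofFinsupp _
  let w (d : X →₀ ℕ) : LabeledSum (Option {y // y ≠ x}) := (ofFinsupp d).map γ.symm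
  have hw (d : X →₀ ℕ) : ((w d).map γ).toFinsupp = d := by
    rw [toFinsupp_map, toFinsupp_map, toFinsupp_ofFinsupp, ← Finsupp.mapDomain_comp,
      γ.self_comp_symm, Finsupp.mapDomain_id]
  have hwc (d : X →₀ ℕ) : ((w d).bind c.substNone).toFinsupp = collapseSum x (P.b i) d := by
    rw [toFinsupp_bind_substNone hc, toFinsupp_ofFinsupp]
  let a (j : {j // j ≠ i}) := w (P.a j)
  let b (j : {j // j ≠ i}) := w (P.b j)
  have hnone : ((LabeledSum.pure none).map γ).toFinsupp = P.a i := by simpa [γ] using hi.symm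
  obtain ⟨D, hD⟩ := hP.exists_isUniversal K γ (Equiv.optionSubtypeNe i) (consLeft a)
    (consRight c b) (Option.rec hnone fun j => hw (P.a j))
    (Option.rec (toFinsupp_map_some hc hx) fun j => hw (P.b j))
  obtain ⟨D', hD'⟩ := (P.isBasic_collapse hP x i hx).exists_isUniversal K (.refl _) (.refl _)
    (c.elimNone a) (c.elimNone b) (fun j => hwc (P.a j)) fun j => hwc (P.b j)
  exact isMoritaEquivalent_of_isUniversal hD hD'

end BergmanPresentation

namespace BergmanGraph

variable {V : Type v} {E : Type w}

theorem isBasic_collapse (H : BergmanGraph V E) (hH : H.IsBasic) (v : V) (h : E)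
    (hv : H.r h v = 0) : (H.collapse hH v h hv).IsBasic := by
  refine Set.eq_univ_of_forall fun y g hg => ?_
  have : g.1 ∈ H.blue := hg
  simp [hH.blue_eq_empty] at this

theorem IsBasic.toPresentation [Fintype V] {H : BergmanGraph V E} (hH : H.IsBasic) :
    H.toPresentation.IsBasic := hH

theorem toPresentation_collapse [Fintype V] [DecidableEq V] (H : BergmanGraph V E)
    (hH : H.IsBasic) (v : V) (h : E) (hv : H.r h v = 0) :
    (H.collapse hH v h hv).toPresentation = H.toPresentation.collapse hH.toPresentation v h hv := by
  have hcollapse (m n : V → ℕ) :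
      Finsupp.equivFunOnFinite.symm (fun u : {u : V // u ≠ v} => n u + n v * m u) =
        collapseSum v (Finsupp.equivFunOnFinite.symm m) (Finsupp.equivFunOnFinite.symm n) :=
    Finsupp.ext fun u => (substitute_apply_of_ne v (Finsupp.equivFunOnFinite.symm m)
      (Finsupp.equivFunOnFinite.symm n) u.2).symm
  simp only [BergmanGraph.toPresentation, collapse, BergmanPresentation.collapse, hcollapse]

theorem isMoritaEquivalent_collapse (K : Type u) [Field K] [Fintype V] [DecidableEq V]
    (H : BergmanGraph V E) (hH : H.IsBasic) (v : V) (h : E) (hs : H.s h = Pi.single v 1)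
    (hv : H.r h v = 0) :
    IsMoritaEquivalent K ((H.collapse hH v h hv).algebra K) (H.algebra K) := by
  unfold BergmanGraph.algebra
  rw [H.toPresentation_collapse hH v h hv]
  exact H.toPresentation.isMoritaEquivalent_collapse K hH.toPresentation v h
    ((congrArg _ hs).trans (Finsupp.equivFunOnFinite_symm_single v 1)) hv

end BergmanGraph

end Bergman

end

theorem mainTheorem4_general (K : Type u) [Field K] :
    (∀ (X : Type v) (I : Type w) [Fintype X] [DecidableEq X]
      (P : Bergman.BergmanPresentation X I), ∀ (hP : P.IsBasic)
      (x : X) (i : I), P.a i = Finsupp.single x 1 → ∀ hx : P.b i x = 0,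
        (P.collapse hP x i hx).IsBasic ∧
          IsMoritaEquivalent K ((P.collapse hP x i hx).algebra K) (P.algebra K)) ∧
    (∀ (V : Type v) (E : Type w) [Fintype V] [DecidableEq V]
      (H : Bergman.BergmanGraph V E), ∀ (hH : H.IsBasic)
      (v : V) (h : E), H.s h = Pi.single v 1 → ∀ hv : H.r h v = 0,
        (H.collapse hH v h hv).IsBasic ∧
          IsMoritaEquivalent K ((H.collapse hH v h hv).algebra K) (H.algebra K)) :=
  ⟨fun _ _ _ _ P hP x i hi hx =>
    ⟨P.isBasic_collapse hP x i hx, P.isMoritaEquivalent_collapse K hP x i hi hx⟩,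
  fun _ _ _ _ H hH v h hs hv =>
    ⟨H.isBasic_collapse hH v h hv, H.isMoritaEquivalent_collapse K hH v h hs hv⟩⟩

theorem mainTheorem4 (K : Type u) [Field K] :
    (∀ (X : Type v) (I : Type w) [Fintype X] [DecidableEq X] [Finite I]
      (P : Bergman.BergmanPresentation X I), ∀ (hP : P.IsBasic)
      (x : X) (i : I), P.a i = Finsupp.single x 1 → ∀ hx : P.b i x = 0,
        (P.collapse hP x i hx).IsBasic ∧
          IsMoritaEquivalent K ((P.collapse hP x i hx).algebra K) (P.algebra K)) ∧
    (∀ (V : Type v) (E : Type w) [Fintype V] [DecidableEq V] [Finite E]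
      (H : Bergman.BergmanGraph V E), ∀ (hH : H.IsBasic)
      (v : V) (h : E), H.s h = Pi.single v 1 → ∀ hv : H.r h v = 0,
        (H.collapse hH v h hv).IsBasic ∧
          IsMoritaEquivalent K ((H.collapse hH v h hv).algebra K) (H.algebra K)) :=
  ⟨fun X I _ _ _ => (mainTheorem4_general K).1 X I, fun V E _ _ _ => (mainTheorem4_general K).2 V E⟩
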